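/- **Conventions.** All Hilbert spaces are complex. A bounded operator $T:E\to F$ between Hilbert spaces is *Schmidt decomposable* if there are orthonormal systems $(f_i)$ in $F$ and $(g_i)$ in $E$ and numbers $s_i>0$ with $Th=\sum_i s_i\langle h,g_i\rangle f_i$ for all $h\in E$ (the index set is arbitrary; it is automatically countable when the spaces are separable). A bounded operator on a Hilbert space is *diagonalizable* if the space has an orthonormal basis of eigenvectors of it. For a closed subspace $\mathcal L_0$ of $\mathcal H$ with orthogonal projection $P_0$, $\mathbf{Sd}_{\mathcal L_0}$ is the set of unitary operators $U$ on $\mathcal H$ such that $P_0U|_{\mathcal L_0}:\mathcal L_0\to\mathcal L_0$ is Schmidt decomposable. For closed subspaces $\mathcal S,\mathcal T$ of $\mathcal H$ with orthogonal projections $P_{\mathcal S},P_{\mathcal T}$, the generic part is the orthogonal complement $\mathcal H'$ of $(\mathcal S\cap\mathcal T)\oplus(\mathcal S^\perp\cap\mathcal T^\perp)\oplus(\mathcal S\cap\mathcal T^\perp)\oplus(\mathcal S^\perp\cap\mathcal T)$. A *Halmos model* of the pair consists of a Hilbert space $\mathcal L$ and an operator $X$ on $\mathcal L$ with $0\le X\le\pi/2$,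 such that $X$, $C=\cos X$ and $S=\sin X$ have trivial nullspaces and some unitary isomorphism $\mathcal H'\simeq\mathcal L\times\mathcal L$ carries the restrictions of $P_{\mathcal S}$ and $P_{\mathcal T}$ to $\mathcal H'$ to $$\begin{pmatrix}1&0\\0&0\end{pmatrix}\quad\text{and}\quad\begin{pmatrix}C^2&CS\\CS&S^2\end{pmatrix};$$ $X$ is then called the *Halmos angle operator*. **Theorem.** Let $\mathcal H$ be a Hilbert space and $Q$ a bounded idempotent on $\mathcal H$ with range $R(Q)=\mathcal L_0$ and nullspace $N(Q)$. Let $$Q=\begin{pmatrix}1&A\\0&0\end{pmatrix}$$ be its matrix with respect to $\mathcal H=\mathcal L_0\oplus\mathcal L_0^\perp$, i.e. $A=P_0Q|_{\mathcal L_0^\perp}:\mathcal L_0^\perp\to\mathcal L_0$, and let $\rho_Q$ be the unitary part of the polar decomposition $2Q-I=\rho_Q\,|2Q-I|$ of the invertible operator $2Q-I$. Then the pair $R(Q),N(Q)$ has a Halmos model, and for every such model, with angle operator $X$, the following are equivalent: 1. $\rho_Q\in\mathbf{Sd}_{\mathcal L_0}$; 2. $X$ is diagonalizable; 3. $QQ^*$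 is diagonalizable; 4. $Q^*Q$ is diagonalizable; 5. $A$ is Schmidt decomposable. -/

import Mathlib

open scoped InnerProductSpace

universe u v

noncomputable section

/-- `T` is Schmidt decomposable (has a singular value decomposition):
`T = ∑ sᵢ fᵢ ⊗ gᵢ` (strongly convergent) with orthonormal systems `f`, `g` and numbers `sᵢ > 0`,
where `(f ⊗ g) h = ⟨h, g⟩ f` with `⟨·,·⟩` linear in the first variable (Mathlib's `inner` is linear
in the second one).  The index set is arbitrary; it is automatically countable if the space is
separable. -/
def IsSchmidtDecomposable {E F : Type u} [NormedAddCommGroup E] [InnerProductSpace ℂ E]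
    [NormedAddCommGroup F] [InnerProductSpace ℂ F] (T : E →L[ℂ] F) : Prop :=
  ∃ (ι : Type u) (f : ι → F) (g : ι → E) (s : ι → ℝ),
    Orthonormal ℂ f ∧ Orthonormal ℂ g ∧ (∀ i, 0 < s i) ∧
      ∀ h : E, HasSum (fun i => (s i : ℂ) • (⟪g i, h⟫_ℂ • f i)) (T h)

/-- `T` is diagonalizable: there is an orthonormal (Hilbert) basis of eigenvectors of `T`. -/
def IsDiagonalizable {E : Type u} [NormedAddCommGroup E] [InnerProductSpace ℂ E]
    (T : E →L[ℂ] E) : Prop :=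
  ∃ (ι : Type u) (b : HilbertBasis ι ℂ E) (c : ι → ℂ), ∀ i, T (b i) = c i • b i

section

variable {H : Type u} [NormedAddCommGroup H] [InnerProductSpace ℂ H]

/-- The set `Sd_{L₀}` of the unitary operators `U` of `H` such that `P₀ U|_{L₀} : L₀ → L₀` is
Schmidt decomposable. -/
def Sd [CompleteSpace H] (L₀ : Submodule ℂ H) [L₀.HasOrthogonalProjection] :
    Set (H →L[ℂ] H) :=
  {U | U ∈ unitary (H →L[ℂ] H) ∧
    IsSchmidtDecomposable (L₀.orthogonalProjectionOnto ∘L U ∘L L₀.subtypeL)}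

/-- The `1,2` entry `P₀ Q|_{L₀ᗮ} : L₀ᗮ → L₀` of `Q` with respect to `H = L₀ ⊕ L₀ᗮ`. -/
def upperRightEntry (L₀ : Submodule ℂ H) [L₀.HasOrthogonalProjection] (Q : H →L[ℂ] H) :
    L₀ᗮ →L[ℂ] L₀ :=
  L₀.orthogonalProjectionOnto ∘L Q ∘L L₀ᗮ.subtypeL

/-- The generic part of a pair of closed subspaces `S`, `T`. -/
def genericPart (S T : Submodule ℂ H) : Submodule ℂ H :=
  ((S ⊓ T) ⊔ (Sᗮ ⊓ Tᗮ) ⊔ (S ⊓ Tᗮ) ⊔ (Sᗮ ⊓ T))ᗮ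

/-- `X`, acting in `L`, is the angle operator of a Halmos model of the pair of closed subspaces
`S`, `T`: `0 ≤ X ≤ π/2`, the operators `X`, `C = cos X`, `S = sin X` have trivial nullspaces, and
some unitary isomorphism from the generic part onto `L × L` (with the Hilbert space norm) carries
the restrictions of `P_S` and `P_T` to the matrices `[1, 0; 0, 0]` and `[C², CS; CS, S²]`. -/
def IsHalmosAngle (S T : Submodule ℂ H) [S.HasOrthogonalProjection] [T.HasOrthogonalProjection]
    {L : Type v} [NormedAddCommGroup L] [InnerProductSpace ℂ L] [CompleteSpace L]
    (X : L →L[ℂ] L) : Prop :=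
  0 ≤ X ∧ X ≤ (Real.pi / 2) • (1 : L →L[ℂ] L) ∧
  (∀ x, X x = 0 → x = 0) ∧
  (∀ x, (cfc Real.cos X) x = 0 → x = 0) ∧
  (∀ x, (cfc Real.sin X) x = 0 → x = 0) ∧
  ∃ W : WithLp 2 (L × L) ≃ₗᵢ[ℂ] genericPart S T, ∀ x y : L,
    S.starProjection (W (WithLp.toLp 2 (x, y))) = W (WithLp.toLp 2 (x, 0)) ∧
    T.starProjection (W (WithLp.toLp 2 (x, y))) =
      W (WithLp.toLp 2
        ((cfc Real.cos X ^ 2) x + (cfc Real.cos X * cfc Real.sin X) y,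
          (cfc Real.cos X * cfc Real.sin X) x + (cfc Real.sin X ^ 2) y))

/-- The unitary part `T |T|⁻¹` of the polar decomposition `T = U |T|` of an invertible operator
`T`; see `polarUnitary_mem_unitary`, `polarUnitary_mul_abs` and `eq_polarUnitary`. -/
def polarUnitary [CompleteSpace H] (T : H →L[ℂ] H) : H →L[ℂ] H :=
  T * Ring.inverse (CFC.abs T)

/-- `ρ_Q`, the unitary part of the polar decomposition `2Q - I = ρ_Q |2Q - I|`;
`2Q - I` is invertible for idempotent `Q`, see `isUnit_two_mul_sub_one`. -/
def rho [CompleteSpace H] (Q : H →L[ℂ] H) : H →L[ℂ] H :=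
  polarUnitary (2 * Q - 1)

theorem isUnit_two_mul_sub_one {Q : H →L[ℂ] H} (hQ : IsIdempotentElem Q) :
    IsUnit (2 * Q - 1) := by
  have h : (2 * Q - 1) * (2 * Q - 1) = 1 := by
    have e : (2 * Q - 1) * (2 * Q - 1) = 4 * (Q * Q) - 4 * Q + 1 := by noncomm_ring
    rw [e, hQ.eq, sub_self, zero_add]
  exact ⟨⟨_, _, h, h⟩, rfl⟩

variable [CompleteSpace H]

theorem isUnit_abs_of_isUnit {T : H →L[ℂ] H} (hT : IsUnit T) : IsUnit (CFC.abs T) := by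
  have h : IsUnit (CFC.abs T * CFC.abs T) := by
    rw [CFC.abs_mul_abs]; exact hT.star.mul hT
  rw [← pow_two] at h
  exact (isUnit_pow_iff two_ne_zero).1 h

theorem polarUnitary_mul_abs {T : H →L[ℂ] H} (hT : IsUnit T) :
    polarUnitary T * CFC.abs T = T := by
  rw [polarUnitary, mul_assoc, Ring.inverse_mul_cancel _ (isUnit_abs_of_isUnit hT), mul_one]

theorem eq_polarUnitary {T U : H →L[ℂ] H} (hT : IsUnit T) (hU : U * CFC.abs T = T) :
    U = polarUnitary T :=
  (isUnit_abs_of_isUnit hT).mul_right_cancel (hU.trans (polarUnitary_mul_abs hT).symm)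

theorem polarUnitary_mem_unitary {T : H →L[ℂ] H} (hT : IsUnit T) :
    polarUnitary T ∈ unitary (H →L[ℂ] H) := by
  have ha := isUnit_abs_of_isUnit hT
  have hs : star (CFC.abs T) = CFC.abs T := (CFC.abs_nonneg T).isSelfAdjoint
  have h1 : star (polarUnitary T) * polarUnitary T = 1 := by
    apply ha.mul_right_cancel
    apply ha.mul_left_cancel
    have : CFC.abs T * (star (polarUnitary T) * polarUnitary T * CFC.abs T)
        = star (polarUnitary T * CFC.abs T) * (polarUnitary T * CFC.abs T) := by
      rw [star_mul, hs]; simp only [mul_assoc]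
    rw [this, polarUnitary_mul_abs hT, one_mul, CFC.abs_mul_abs]
  have hu : IsUnit (polarUnitary T) := by
    rw [polarUnitary]
    exact hT.mul ha.ringInverse
  refine Unitary.mem_iff.2 ⟨h1, ?_⟩
  apply hu.mul_right_cancel
  rw [mul_assoc, h1, mul_one, one_mul]

end

end

/-!
All the operators in the theorem are compared with one self-adjoint operator,
`D = P₀ P_{N(Q)ᗮ} P₀` (`complementCompression`), where `P₀` projects onto `L₀ = R(Q)`.
Diagonalizability is handled in the basis-free form `EigenvectorsTotal`: no nonzero vector is
orthogonal to all eigenvectors.  For self-adjoint operators on a Hilbert space this is equivalent to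
diagonalizability, and it passes along intertwining operators and continuous functions.  An operator
`T` is Schmidt decomposable if and only if `T† T` is diagonalizable
(`isSchmidtDecomposable_iff_eigenvectorsTotal`), and `T† T` and `T T†` are diagonalizable together
(`eigenvectorsTotal_comp_adjoint_iff`).

* `ρ = ρ_Q` is a symmetry with `ρ Q = Q⋆ ρ`, because `(2Q - 1)² = 1`.  It maps `R(Q)` onto
  `R(Q⋆) = N(Q)ᗮ`, so `ρ P₀ ρ = P_{N(Q)ᗮ}` and `(P₀ ρ P₀)² = D`.  Hence the compression of `ρ` to
  `L₀` is Schmidt decomposable exactly if `D` is diagonalizable (`rho_mem_Sd_iff`).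
* `Q Q⋆` and `D` vanish on `L₀ᗮ` and are inverse to each other on `L₀`, so they have the same
  eigenvectors (`eigenvectorsTotal_mul_star_iff`).
* On `L₀` one has `A A† = Q Q⋆ - 1` (`isSchmidtDecomposable_upperRightEntry_iff`).
* In a Halmos model `D` is `sin² X ⊕ 0` on the generic part and `0` or `1` on each of the four
  special subspaces, and `X = arcsin √(sin² X)` (`IsHalmosAngle.eigenvectorsTotal_iff`).

A Halmos model exists for every pair of closed subspaces (`exists_isHalmosAngle`): on the part of
the first subspace inside the generic part, `X` is the arccosine of the square root of the compression
of the second projection, and the two copies of the model space are identified by the unitary part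
of the polar decomposition of the off-diagonal entry of that projection.
-/

/-! ### Total sets of eigenvectors -/

section

variable {E F : Type*} [NormedAddCommGroup E] [InnerProductSpace ℂ E]
  [NormedAddCommGroup F] [InnerProductSpace ℂ F]

/-- The eigenvectors of `T` form a total set: only `0` is orthogonal to all of them.  For a
self-adjoint operator on a Hilbert space this is diagonalizability, see
`isDiagonalizable_iff_eigenvectorsTotal`, but it involves no choice of a basis and no index type. -/
def EigenvectorsTotal (T : E →L[ℂ] E) : Prop :=
  ∀ z : E, (∀ (μ : ℂ) (v : E), T v = μ • v → ⟪v, z⟫_ℂ = 0) → z = 0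

theorem EigenvectorsTotal.mono {T S : E →L[ℂ] E} (hT : EigenvectorsTotal T)
    (h : ∀ (μ : ℂ) (v : E), T v = μ • v → ∃ ν : ℂ, S v = ν • v) : EigenvectorsTotal S :=
  fun z hz => hT z fun μ v hv => (h μ v hv).elim fun ν hν => hz ν v hν

theorem IsDiagonalizable.eigenvectorsTotal {T : E →L[ℂ] E} (hT : IsDiagonalizable T) :
    EigenvectorsTotal T := by
  obtain ⟨ι, b, c, hb⟩ := hT
  intro z hz
  have h := b.hasSum_repr z
  have h0 : (fun i => b.repr z i • b i) = fun _ => 0 := by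
    funext i
    rw [b.repr_apply_apply, hz (c i) (b i) (hb i), zero_smul]
  rw [h0] at h
  exact h.unique hasSum_zero

/-- Orthonormal bases of the eigenspaces, which are mutually orthogonal, combine to an orthonormal
basis of the whole space. -/
theorem isDiagonalizable_iff_eigenvectorsTotal [CompleteSpace E] {T : E →L[ℂ] E}
    (hT : IsSelfAdjoint T) : IsDiagonalizable T ↔ EigenvectorsTotal T := by
  refine ⟨IsDiagonalizable.eigenvectorsTotal, fun h => ?_⟩
  have hsym : (T : E →ₗ[ℂ] E).IsSymmetric := ContinuousLinearMap.isSelfAdjoint_iff_isSymmetric.1 hT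
  let V : ℂ → Submodule ℂ E := fun μ => Module.End.eigenspace (T : E →ₗ[ℂ] E) μ
  have hVclosed : ∀ μ, IsClosed (V μ : Set E) := fun μ => by
    have : (V μ : Set E) = {x | T x = μ • x} := by
      ext x
      simp [V]
    rw [this]
    exact isClosed_eq T.continuous (continuous_const_smul μ)
  have hVcomplete : ∀ μ, CompleteSpace (V μ) := fun μ => (hVclosed μ).completeSpace_coe
  choose w b hb using fun μ => exists_hilbertBasis ℂ (V μ)
  have horth : Orthonormal ℂ fun a : Σ μ, w μ => (b a.1 a.2 : E) :=
    hsym.orthogonalFamily_eigenspaces.orthonormal_sigma_orthonormal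
      (v_family := fun μ i => b μ i) fun μ => (b μ).orthonormal
  have hspan : (Submodule.span ℂ (Set.range fun a : Σ μ, w μ => (b a.1 a.2 : E)))ᗮ = ⊥ := by
    rw [Submodule.eq_bot_iff]
    intro z hz
    refine h z fun μ v hv => ?_
    have hvV : v ∈ V μ := Module.End.mem_eigenspace_iff.2 hv
    have hs := ((b μ).hasSum_repr ⟨v, hvV⟩).mapL ((innerSL ℂ z).comp (V μ).subtypeL)
    have h0 : (fun i => ((innerSL ℂ z).comp (V μ).subtypeL)
        ((b μ).repr ⟨v, hvV⟩ i • (b μ i))) = fun _ => 0 := by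
      funext i
      rw [map_smul]
      have : ⟪z, (b μ i : E)⟫_ℂ = 0 :=
        inner_eq_zero_symm.1 ((Submodule.mem_orthogonal _ z).1 hz _
          (Submodule.subset_span (Set.mem_range_self (⟨μ, i⟩ : Σ μ, w μ))))
      simp [this]
    rw [h0] at hs
    have := hs.unique hasSum_zero
    exact inner_eq_zero_symm.1 (by simpa using this)
  refine ⟨_, HilbertBasis.mkOfOrthogonalEqBot horth hspan, fun a => a.1, fun a => ?_⟩
  rw [HilbertBasis.coe_mkOfOrthogonalEqBot]
  exact Module.End.mem_eigenspace_iff.1 (b a.1 a.2).2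

variable [CompleteSpace E] [CompleteSpace F]

open ContinuousLinearMap in
/-- If `V` intertwines `R` and `T`, then `V†` maps eigenvectors of `T` to eigenvectors of `R`. -/
theorem EigenvectorsTotal.of_intertwining {R : E →L[ℂ] E} {T : F →L[ℂ] F} (hT : EigenvectorsTotal T)
    (hR' : IsSelfAdjoint R) (hT' : IsSelfAdjoint T) (V : E →L[ℂ] F)
    (hV : Function.Injective V) (h : T ∘L V = V ∘L R) : EigenvectorsTotal R := by
  intro x hx
  refine hV ((hT (V x) fun μ v hv => ?_).trans (map_zero V).symm)
  have h' : adjoint V ∘L T = R ∘L adjoint V := by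
    have := congrArg adjoint h
    rwa [adjoint_comp, adjoint_comp, hR'.adjoint_eq, hT'.adjoint_eq] at this
  rw [← adjoint_inner_left]
  refine hx μ _ ?_
  have := congrArg (fun S : F →L[ℂ] E => S v) h'
  simp only [comp_apply, hv, map_smul] at this
  exact this.symm

open ContinuousLinearMap in
/-- Converse to `EigenvectorsTotal.of_intertwining`, provided that the orthogonal complement of
the range of `V` is taken care of. -/
theorem EigenvectorsTotal.map_intertwining {R : E →L[ℂ] E} {T : F →L[ℂ] F}
    (hR : EigenvectorsTotal R) (V : E →L[ℂ] F) (h : T ∘L V = V ∘L R)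
    (hc : ∀ z : F, (∀ x, ⟪V x, z⟫_ℂ = 0) →
      (∀ (μ : ℂ) (v : F), T v = μ • v → ⟪v, z⟫_ℂ = 0) → z = 0) :
    EigenvectorsTotal T := by
  intro z hz
  have h0 : adjoint V z = 0 := hR _ fun μ v hv => by
    rw [adjoint_inner_right]
    refine hz μ _ ?_
    have := congrArg (fun S : E →L[ℂ] F => S v) h
    simpa only [comp_apply, hv, map_smul] using this
  exact hc z (fun x => by rw [← adjoint_inner_right, h0, inner_zero_right]) hz

open ContinuousLinearMap in
/-- `T†` maps eigenvectors of `T T†` to eigenvectors of `T† T`, and the orthogonal complement of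
its range is the nullspace of `T`. -/
theorem EigenvectorsTotal.adjoint_comp_self {T : E →L[ℂ] F}
    (h : EigenvectorsTotal (T ∘L adjoint T)) : EigenvectorsTotal (adjoint T ∘L T) := by
  refine h.map_intertwining (adjoint T) rfl fun z hz hz' => ?_
  have hT : T z = 0 := by
    have := hz (T z)
    rwa [adjoint_inner_left, inner_self_eq_zero] at this
  exact inner_self_eq_zero.1 (hz' 0 z (by simp [hT]))

open ContinuousLinearMap in
theorem eigenvectorsTotal_comp_adjoint_iff {T : E →L[ℂ] F} :
    EigenvectorsTotal (T ∘L adjoint T) ↔ EigenvectorsTotal (adjoint T ∘L T) := by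
  refine ⟨fun h => h.adjoint_comp_self, fun h => ?_⟩
  have := EigenvectorsTotal.adjoint_comp_self (T := adjoint T) (by rwa [adjoint_adjoint])
  rwa [adjoint_adjoint] at this

end

/-! ### Schmidt decompositions -/

section

variable {E F : Type u} [NormedAddCommGroup E] [InnerProductSpace ℂ E] [CompleteSpace E]
  [NormedAddCommGroup F] [InnerProductSpace ℂ F] [CompleteSpace F]

open ContinuousLinearMap in
/-- The right singular vectors of `T` together with the nullspace of `T` are eigenvectors of
`T† T`. -/
theorem IsSchmidtDecomposable.eigenvectorsTotal {T : E →L[ℂ] F} (hT : IsSchmidtDecomposable T) :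
    EigenvectorsTotal (adjoint T ∘L T) := by
  obtain ⟨ι, f, g, s, hf, hg, -, hsum⟩ := hT
  have hTg : ∀ j, T (g j) = (s j : ℂ) • f j := fun j => by
    refine (hsum (g j)).unique ?_
    have := hasSum_single (f := fun i => (s i : ℂ) • (⟪g i, g j⟫_ℂ • f i)) j fun i hi => by
      rw [hg.2 hi, zero_smul, smul_zero]
    simpa [inner_self_eq_norm_sq_to_K, hg.1 j] using this
  have hTf : ∀ j, adjoint T (f j) = (s j : ℂ) • g j := fun j => by
    refine ext_inner_right ℂ fun h => ?_
    rw [adjoint_inner_left, inner_smul_left, Complex.conj_ofReal]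
    have h1 := (hsum h).mapL (innerSL ℂ (f j))
    have h2 := hasSum_single (f := fun i => innerSL ℂ (f j) ((s i : ℂ) • (⟪g i, h⟫_ℂ • f i))) j
      fun i hi => by simp [hf.2 hi.symm]
    simpa [inner_self_eq_norm_sq_to_K, hf.1 j] using h1.unique h2
  intro z hz
  have hgz : ∀ j, ⟪g j, z⟫_ℂ = 0 := fun j =>
    hz (s j * s j) (g j) (by rw [comp_apply, hTg, map_smul, hTf, smul_smul])
  have hTz : T z = 0 := by
    refine (hsum z).unique ?_
    simp only [hgz, zero_smul, smul_zero]
    exact hasSum_zero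
  exact inner_self_eq_zero.1 (hz 0 z (by simp [hTz]))

open ContinuousLinearMap in
/-- From an orthonormal basis of eigenvectors of `T† T`, discard the vectors killed by `T`; the
images of the others are mutually orthogonal. -/
theorem isSchmidtDecomposable_iff_eigenvectorsTotal {T : E →L[ℂ] F} :
    IsSchmidtDecomposable T ↔ EigenvectorsTotal (adjoint T ∘L T) := by
  refine ⟨IsSchmidtDecomposable.eigenvectorsTotal, fun h => ?_⟩
  have hsa : IsSelfAdjoint (adjoint T ∘L T) := (isPositive_adjoint_comp_self T).isSelfAdjoint
  obtain ⟨ι, b, c, hb⟩ := (isDiagonalizable_iff_eigenvectorsTotal hsa).2 h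
  have hpos : ∀ i : {i // T (b i) ≠ 0}, 0 < ‖T (b i)‖ := fun i => norm_pos_iff.2 i.2
  refine ⟨{i // T (b i) ≠ 0}, fun i => ((‖T (b i)‖ : ℂ)⁻¹) • T (b i), fun i => b i,
    fun i => ‖T (b i)‖, ⟨fun i => ?_, fun i j hij => ?_⟩,
    b.orthonormal.comp _ Subtype.coe_injective, hpos, fun x => ?_⟩
  · rw [norm_smul, norm_inv, Complex.norm_real, norm_norm, inv_mul_cancel₀ (hpos i).ne']
  · have hij' : (i : ι) ≠ j := fun h => hij (Subtype.ext h)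
    have : ⟪T (b i), T (b j)⟫_ℂ = 0 := by
      rw [← adjoint_inner_right, ← comp_apply, hb, inner_smul_right, b.orthonormal.2 hij',
        mul_zero]
    simp only [inner_smul_left, inner_smul_right, this, mul_zero]
  · have h1 := (b.hasSum_repr x).mapL T
    have h2 := (hasSum_subtype_iff_of_support_subset (f := fun i => T (b.repr x i • b i))
      (s := {i | T (b i) ≠ 0}) (fun i hi hi' => hi (by simp [hi']))).2 h1
    convert! h2 using 1
    funext i
    have hne : (‖T (b i)‖ : ℂ) ≠ 0 := Complex.ofReal_ne_zero.2 (hpos i).ne'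
    simp only [Function.comp_apply, map_smul, b.repr_apply_apply]
    rw [smul_comm, smul_smul (‖T (b i)‖ : ℂ), mul_inv_cancel₀ hne, one_smul]

end

/-! ### Functions of a self-adjoint operator -/

section

variable {E : Type*} [NormedAddCommGroup E] [InnerProductSpace ℂ E] [CompleteSpace E]

/-- The functions `f` for which `f(T) v = f(μ) v` form a closed subalgebra containing the
identity function. -/
theorem cfc_apply_of_apply_eq_smul {T : E →L[ℂ] E} (hT : IsSelfAdjoint T) {μ : ℝ} {v : E}
    (hv : T v = (μ : ℂ) • v) {f : ℝ → ℝ} (hf : ContinuousOn f (spectrum ℝ T)) :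
    (cfc f T) v = (f μ : ℂ) • v := by
  rcases eq_or_ne v 0 with rfl | hv0
  · simp
  have hμ : μ ∈ spectrum ℝ T := by
    intro hu
    have h1 : (algebraMap ℝ (E →L[ℂ] E) μ - T) v = 0 := by
      rw [sub_apply, hv, Algebra.algebraMap_eq_smul_one]
      simp
    obtain ⟨u, hu⟩ := hu
    have h2 : ((u⁻¹ : (E →L[ℂ] E)ˣ) * (u : E →L[ℂ] E)) v = 0 := by
      rw [mul_apply_eq_comp, hu, h1, map_zero]
    rw [Units.inv_mul] at h2
    exact hv0 h2
  rw [cfc_apply f T hT hf]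
  suffices h : ∀ g : C(spectrum ℝ T, ℝ), (cfcHom hT g) v = (g ⟨μ, hμ⟩ : ℂ) • v from h _
  intro g
  induction g using ContinuousMap.induction_on_of_compact with
  | const r =>
    have : ContinuousMap.const (spectrum ℝ T) r = algebraMap ℝ _ r := rfl
    rw [this, AlgHomClass.commutes, Algebra.algebraMap_eq_smul_one]
    simp
  | id => rw [cfcHom_id hT]; exact hv
  | star_id => rw [star_trivial, cfcHom_id hT]; exact hv
  | add f g hf hg => simp [hf, hg, add_smul]
  | mul f g hf hg =>
    rw [map_mul, mul_apply_eq_comp, hg, map_smul, hf, smul_smul, mul_comm, ContinuousMap.mul_apply,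
      Complex.ofReal_mul]
  | frequently f h =>
    have h1 : Continuous fun g : C(spectrum ℝ T, ℝ) => (cfcHom hT g) v :=
      (ContinuousLinearMap.apply ℂ E v).continuous.comp (cfcHom_continuous hT)
    have h2 : Continuous fun g : C(spectrum ℝ T, ℝ) => g ⟨μ, hμ⟩ := continuous_eval_const _
    have hcl : IsClosed {g : C(spectrum ℝ T, ℝ) | (cfcHom hT g) v = (g ⟨μ, hμ⟩ : ℂ) • v} :=
      isClosed_eq h1 (by fun_prop)
    exact hcl.mem_of_frequently_of_tendsto h Filter.tendsto_id

theorem exists_real_eq_of_isSelfAdjoint {T : E →L[ℂ] E} (hT : IsSelfAdjoint T) {μ : ℂ} {v : E}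
    (hv : T v = μ • v) : ∃ r : ℝ, T v = (r : ℂ) • v := by
  rcases eq_or_ne v 0 with rfl | hv0
  · exact ⟨0, by simp⟩
  have hsym : (T : E →ₗ[ℂ] E).IsSymmetric := ContinuousLinearMap.isSelfAdjoint_iff_isSymmetric.1 hT
  have h := hsym.conj_eigenvalue_eq_self
    (Module.End.hasEigenvalue_of_hasEigenvector ⟨Module.End.mem_eigenspace_iff.2 hv, hv0⟩)
  obtain ⟨r, rfl⟩ := Complex.conj_eq_iff_real.1 h
  exact ⟨r, hv⟩

theorem EigenvectorsTotal.cfc {T : E →L[ℂ] E} (h : EigenvectorsTotal T) (hT : IsSelfAdjoint T)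
    {f : ℝ → ℝ} (hf : ContinuousOn f (spectrum ℝ T)) : EigenvectorsTotal (cfc f T) := by
  refine h.mono fun μ v hv => ?_
  obtain ⟨r, hr⟩ := exists_real_eq_of_isSelfAdjoint hT hv
  exact ⟨_, cfc_apply_of_apply_eq_smul hT hr hf⟩

theorem spectrum_subset_Icc {X : E →L[ℂ] E} {r : ℝ} (h0 : 0 ≤ X)
    (h1 : X ≤ r • (1 : E →L[ℂ] E)) : spectrum ℝ X ⊆ Set.Icc 0 r := fun x hx =>
  ⟨spectrum_nonneg_of_nonneg h0 hx, by
    rw [← Algebra.algebraMap_eq_smul_one] at h1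
    exact (le_algebraMap_iff_spectrum_le (ha := h0.isSelfAdjoint)).1 h1 x hx⟩

theorem cfc_cos_sq_add_cfc_sin_sq {X : E →L[ℂ] E} (hX : IsSelfAdjoint X) :
    cfc Real.cos X ^ 2 + cfc Real.sin X ^ 2 = 1 := by
  rw [← cfc_pow _ 2 X, ← cfc_pow _ 2 X, ← cfc_add X _ _]
  simp only [Real.cos_sq_add_sin_sq]
  exact cfc_const_one ℝ X

/-- On `[0, π/2]` the function `sin²` has the continuous left inverse `arcsin ∘ √`, so the angle
operator is a function of `sin² X`. -/
theorem eigenvectorsTotal_sin_sq_iff {X : E →L[ℂ] E} (h0 : 0 ≤ X)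
    (h1 : X ≤ (Real.pi / 2) • (1 : E →L[ℂ] E)) :
    EigenvectorsTotal (cfc Real.sin X ^ 2) ↔ EigenvectorsTotal X := by
  have hX : IsSelfAdjoint X := h0.isSelfAdjoint
  have hs : cfc Real.sin X ^ 2 = cfc (fun x => Real.sin x ^ 2) X := (cfc_pow _ 2 X).symm
  rw [hs]
  refine ⟨fun h => ?_, fun h => h.cfc hX (by fun_prop)⟩
  have hinv : cfc (fun y => Real.arcsin (√y)) (cfc (fun x => Real.sin x ^ 2) X) = X := by
    rw [← cfc_comp' (fun y => Real.arcsin (√y)) (fun x => Real.sin x ^ 2) X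
      (Real.continuous_arcsin.comp Real.continuous_sqrt).continuousOn]
    refine (cfc_congr fun x hx => ?_).trans (cfc_id ℝ X)
    obtain ⟨hx0, hx1⟩ := spectrum_subset_Icc h0 h1 hx
    simp only [id]
    rw [Real.sqrt_sq (Real.sin_nonneg_of_nonneg_of_le_pi hx0 (by linarith [Real.pi_pos])),
      Real.arcsin_sin (by linarith [Real.pi_pos]) hx1]
  rw [← hinv]
  exact h.cfc (cfc_predicate _ X) (Real.continuous_arcsin.comp Real.continuous_sqrt).continuousOn

end

/-! ### The generic part of two subspaces and the angle operator -/

section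

variable {H : Type u} [NormedAddCommGroup H] [InnerProductSpace ℂ H]

theorem mem_genericPart_iff {S T : Submodule ℂ H} {z : H} :
    z ∈ genericPart S T ↔ (∀ w ∈ S ⊓ T, ⟪w, z⟫_ℂ = 0) ∧ (∀ w ∈ Sᗮ ⊓ Tᗮ, ⟪w, z⟫_ℂ = 0) ∧
      (∀ w ∈ S ⊓ Tᗮ, ⟪w, z⟫_ℂ = 0) ∧ (∀ w ∈ Sᗮ ⊓ T, ⟪w, z⟫_ℂ = 0) := by
  rw [genericPart, ← Submodule.inf_orthogonal, ← Submodule.inf_orthogonal,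
    ← Submodule.inf_orthogonal]
  simp only [Submodule.mem_inf, Submodule.mem_orthogonal, and_assoc]

theorem genericPart_comm (S T : Submodule ℂ H) : genericPart S T = genericPart T S := by
  ext z
  simp only [mem_genericPart_iff, inf_comm T, inf_comm Tᗮ]
  tauto

theorem starProjection_mem_genericPart {S T : Submodule ℂ H} [S.HasOrthogonalProjection] {z : H}
    (hz : z ∈ genericPart S T) : S.starProjection z ∈ genericPart S T := by
  rw [mem_genericPart_iff] at hz ⊢
  obtain ⟨h1, h2, h3, h4⟩ := hz
  have hS : ∀ w ∈ S, S.starProjection w = w := fun w hw =>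
    Submodule.starProjection_eq_self_iff.2 hw
  have hS' : ∀ w ∈ Sᗮ, S.starProjection w = 0 := fun w hw =>
    (Submodule.starProjection_apply_eq_zero_iff _).2 hw
  refine ⟨fun w hw => ?_, fun w hw => ?_, fun w hw => ?_, fun w hw => ?_⟩ <;>
    rw [← Submodule.inner_starProjection_left_eq_right]
  · rw [hS w hw.1, h1 w hw]
  · rw [hS' w hw.1, inner_zero_left]
  · rw [hS w hw.1, h3 w hw]
  · rw [hS' w hw.1, inner_zero_left]

theorem starProjection_right_mem_genericPart {S T : Submodule ℂ H} [T.HasOrthogonalProjection]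
    {z : H} (hz : z ∈ genericPart S T) : T.starProjection z ∈ genericPart S T := by
  rw [genericPart_comm] at hz ⊢
  exact starProjection_mem_genericPart hz

/-- A vector of the generic part that lies in one of the four special subspaces vanishes. -/
theorem eq_zero_of_mem_genericPart {S T : Submodule ℂ H} {z : H} (hz : z ∈ genericPart S T)
    (h : z ∈ S ⊓ T ∨ z ∈ Sᗮ ⊓ Tᗮ ∨ z ∈ S ⊓ Tᗮ ∨ z ∈ Sᗮ ⊓ T) : z = 0 := by
  obtain ⟨h1, h2, h3, h4⟩ := mem_genericPart_iff.1 hz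
  rcases h with h | h | h | h
  · exact inner_self_eq_zero.1 (h1 z h)
  · exact inner_self_eq_zero.1 (h2 z h)
  · exact inner_self_eq_zero.1 (h3 z h)
  · exact inner_self_eq_zero.1 (h4 z h)

/-- `P_S P_{Tᗮ} P_S`, the compression of the projection onto `Tᗮ` to `S`, extended by zero.  In a
Halmos model it is `sin² X ⊕ 0` on the generic part. -/
noncomputable def complementCompression (S T : Submodule ℂ H) [S.HasOrthogonalProjection]
    [T.HasOrthogonalProjection] : H →L[ℂ] H :=
  S.starProjection * (1 - T.starProjection) * S.starProjection

theorem complementCompression_apply (S T : Submodule ℂ H) [S.HasOrthogonalProjection]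
    [T.HasOrthogonalProjection] (x : H) : complementCompression S T x =
      S.starProjection (S.starProjection x - T.starProjection (S.starProjection x)) := rfl

variable [CompleteSpace H]

theorem isSelfAdjoint_complementCompression (S T : Submodule ℂ H) [S.HasOrthogonalProjection]
    [T.HasOrthogonalProjection] : IsSelfAdjoint (complementCompression S T) := by
  have hS : IsSelfAdjoint S.starProjection := isSelfAdjoint_starProjection S
  have hT : IsSelfAdjoint T.starProjection := isSelfAdjoint_starProjection T
  have h := IsSelfAdjoint.conjugate ((IsSelfAdjoint.one _).sub hT) S.starProjection
  rwa [hS.star_eq] at h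

/-- The angle operator is diagonalizable if and only if `P_S P_{Tᗮ} P_S` is. -/
theorem IsHalmosAngle.eigenvectorsTotal_iff {S T : Submodule ℂ H} [S.HasOrthogonalProjection]
    [T.HasOrthogonalProjection] {L : Type v} [NormedAddCommGroup L] [InnerProductSpace ℂ L]
    [CompleteSpace L] {X : L →L[ℂ] L} (hX : IsHalmosAngle S T X) :
    EigenvectorsTotal X ↔ EigenvectorsTotal (complementCompression S T) := by
  obtain ⟨h0, h1, -, -, -, W, hW⟩ := hX
  rw [← eigenvectorsTotal_sin_sq_iff h0 h1]
  have hXs : IsSelfAdjoint X := h0.isSelfAdjoint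
  have hcs : ∀ x, x - (cfc Real.cos X ^ 2) x = (cfc Real.sin X ^ 2) x := fun x => by
    rw [sub_eq_iff_eq_add', ← add_apply, cfc_cos_sq_add_cfc_sin_sq hXs, one_apply_eq_self]
  have hD : ∀ x y, complementCompression S T (W (WithLp.toLp 2 (x, y))) =
      W (WithLp.toLp 2 ((cfc Real.sin X ^ 2) x, 0)) := fun x y => by
    rw [complementCompression_apply, (hW x y).1, (hW x 0).2, ← Submodule.coe_sub, ← map_sub,
      ← WithLp.toLp_sub, Prod.mk_sub_mk, (hW _ _).1, map_zero, add_zero, hcs]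
  -- the embedding of `L` into `H` as the first component of the model
  let V : L →ₗᵢ[ℂ] H :=
    { toFun := fun x => W (WithLp.toLp 2 (x, 0))
      map_add' := fun x y => by
        rw [← Submodule.coe_add, ← map_add, ← WithLp.toLp_add, Prod.mk_add_mk, add_zero]
      map_smul' := fun c x => by
        rw [RingHom.id_apply, ← Submodule.coe_smul, ← map_smul, ← WithLp.toLp_smul, Prod.smul_mk,
          smul_zero]
      norm_map' := fun x => by
        change ‖(W (WithLp.toLp 2 (x, 0)) : H)‖ = ‖x‖
        rw [← Submodule.coe_norm, W.norm_map, WithLp.prod_norm_eq_of_L2]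
        simp }
  have hV : ∀ x, V x = W (WithLp.toLp 2 (x, 0)) := fun _ => rfl
  have hint : complementCompression S T ∘L V.toContinuousLinearMap =
      V.toContinuousLinearMap ∘L (cfc Real.sin X ^ 2) := by
    ext x
    exact hD x 0
  have hsa : IsSelfAdjoint (cfc Real.sin X ^ 2) := (cfc_predicate Real.sin X).pow 2
  refine ⟨fun h => h.map_intertwining _ hint fun z hzV hz => ?_, fun h =>
    h.of_intertwining hsa (isSelfAdjoint_complementCompression S T) _ V.injective hint⟩
  have hS : ∀ w ∈ S, S.starProjection w = w := fun w hw =>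
    Submodule.starProjection_eq_self_iff.2 hw
  have hS' : ∀ w ∈ Sᗮ, S.starProjection w = 0 := fun w hw =>
    (Submodule.starProjection_apply_eq_zero_iff _).2 hw
  have hT : ∀ w ∈ T, T.starProjection w = w := fun w hw =>
    Submodule.starProjection_eq_self_iff.2 hw
  have hT' : ∀ w ∈ Tᗮ, T.starProjection w = 0 := fun w hw =>
    (Submodule.starProjection_apply_eq_zero_iff _).2 hw
  have hzg : z ∈ genericPart S T := by
    refine mem_genericPart_iff.2 ⟨fun w hw => hz 0 w ?_, fun w hw => hz 0 w ?_,
      fun w hw => hz 1 w ?_, fun w hw => hz 0 w ?_⟩ <;> rw [complementCompression_apply]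
    · rw [hS w hw.1, hT w hw.2, sub_self, map_zero, zero_smul]
    · rw [hS' w hw.1, map_zero, sub_self, map_zero, zero_smul]
    · rw [hS w hw.1, hT' w hw.2, sub_zero, hS w hw.1, one_smul]
    · rw [hS' w hw.1, map_zero, sub_self, map_zero, zero_smul]
  obtain ⟨p, hp⟩ := W.surjective ⟨z, hzg⟩
  have hinner : ∀ q : WithLp 2 (L × L), ⟪(W q : H), z⟫_ℂ = ⟪q, p⟫_ℂ := fun q => by
    rw [← W.inner_map_map q p, hp, Submodule.coe_inner]
  have hp1 : p.fst = 0 := by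
    have h := hzV p.fst
    rw [LinearIsometry.coe_toContinuousLinearMap, hV, hinner, WithLp.prod_inner_apply] at h
    simpa using h
  have hp2 : p.snd = 0 := by
    have h := hz 0 (W (WithLp.toLp 2 (0, p.snd))) (by
      rw [hD, map_zero, zero_smul, Submodule.coe_eq_zero]
      exact map_zero W)
    rw [hinner, WithLp.prod_inner_apply] at h
    simpa using h
  have hp0 : p = 0 := (WithLp.ofLp_injective 2) (Prod.ext hp1 hp2)
  rw [hp0, map_zero] at hp
  exact (congrArg Subtype.val hp).symm

end

/-! ### The symmetry of an idempotent and its compressions -/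

section

variable {H : Type u} [NormedAddCommGroup H] [InnerProductSpace ℂ H]

section

variable {Q : H →L[ℂ] H} {L₀ : Submodule ℂ H} [L₀.HasOrthogonalProjection]

theorem two_mul_sub_one_mul_self (hQ : IsIdempotentElem Q) : (2 * Q - 1) * (2 * Q - 1) = 1 := by
  have e : (2 * Q - 1) * (2 * Q - 1) = 4 * (Q * Q) - 4 * Q + 1 := by noncomm_ring
  rw [e, hQ.eq, sub_self, zero_add]

theorem starProjection_mul_of_range_eq (hL₀ : Q.range = L₀) : L₀.starProjection * Q = Q := by
  ext x
  exact Submodule.starProjection_eq_self_iff.2 (hL₀ ▸ LinearMap.mem_range_self _ x)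

theorem mul_starProjection_of_range_eq (hQ : IsIdempotentElem Q) (hL₀ : Q.range = L₀) :
    Q * L₀.starProjection = L₀.starProjection := by
  ext x
  have hx : L₀.starProjection x ∈ Q.range := hL₀ ▸ L₀.starProjection_apply_mem x
  obtain ⟨y, hy⟩ := hx
  change Q (L₀.starProjection x) = L₀.starProjection x
  rw [← hy]
  exact congrArg (fun S : H →L[ℂ] H => S y) hQ.eq

theorem mul_one_sub_starProjection_ker [Q.ker.HasOrthogonalProjection] :
    Q * (1 - Q.ker.starProjection) = Q := by
  ext x
  have : Q (Q.ker.starProjection x) = 0 := Q.ker.starProjection_apply_mem x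
  simp [this]

theorem one_sub_starProjection_ker_mul [Q.ker.HasOrthogonalProjection] (hQ : IsIdempotentElem Q) :
    (1 - Q.ker.starProjection) * Q = 1 - Q.ker.starProjection := by
  ext x
  have hx : x - Q x ∈ Q.ker := by
    have := congrArg (fun S : H →L[ℂ] H => S x) hQ.eq
    simp only [mul_apply_eq_comp] at this
    simp [this]
  simp only [mul_apply_eq_comp, sub_apply, one_apply_eq_self]
  rw [sub_eq_sub_iff_sub_eq_sub, ← neg_sub x, ← neg_sub (Q.ker.starProjection x), ← map_sub,
    Submodule.starProjection_eq_self_iff.2 hx]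

/-- If `G` and `D` are supported on the range of the projection `P`, where `D` is a left inverse of
`G`, then every eigenvector of `G` is one of `D`. -/
theorem exists_apply_eq_smul_of_mul_eq {G D P : H →L[ℂ] H} (hDG : D * G = P) (hPG : P * G = G)
    (hDP : D * P = D) {μ : ℂ} {v : H} (hv : G v = μ • v) : ∃ ν : ℂ, D v = ν • v := by
  have happ : ∀ {A B C : H →L[ℂ] H}, A * B = C → ∀ x, A (B x) = C x := fun h x => by
    rw [← h]; rfl
  have h1 : P v = μ • D v := by rw [← happ hDG v, hv, map_smul]
  rcases eq_or_ne μ 0 with rfl | hμ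
  · refine ⟨0, ?_⟩
    rw [← happ hDP v, h1]
    simp
  · refine ⟨μ⁻¹, ?_⟩
    have h2 : P v = v := by
      have := happ hPG v
      rw [hv, map_smul] at this
      exact smul_right_injective _ hμ this
    rw [eq_inv_smul_iff₀ hμ, ← h1, h2]

end

variable [CompleteSpace H]

open ContinuousLinearMap in
/-- An operator `B` of `L₀` is diagonalizable together with its extension by `0` on `L₀ᗮ`. -/
theorem eigenvectorsTotal_iff_of_comp_subtypeL {L₀ : Submodule ℂ H} [CompleteSpace L₀]
    {B : L₀ →L[ℂ] L₀} {T : H →L[ℂ] H}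
    (hB : IsSelfAdjoint B) (hT : IsSelfAdjoint T) (h : T ∘L L₀.subtypeL = L₀.subtypeL ∘L B)
    (h0 : ∀ z ∈ L₀ᗮ, T z = 0) : EigenvectorsTotal B ↔ EigenvectorsTotal T := by
  refine ⟨fun hB' => hB'.map_intertwining _ h fun z hz hz' => ?_, fun hT' =>
    hT'.of_intertwining hB hT _ Subtype.coe_injective h⟩
  have hz0 : z ∈ L₀ᗮ := (L₀.mem_orthogonal z).2 fun u hu => hz ⟨u, hu⟩
  exact inner_self_eq_zero.1 (hz' 0 z (by rw [h0 z hz0, zero_smul]))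

/-- If `T² = 1` and `T = ρ |T|`, then both `ρ |T| ρ⋆` and `|T|⁻¹` are positive square roots of
`T T⋆ = (T⋆ T)⁻¹`.  Hence they agree, and `ρ⋆ |T| = T⁻¹ = T = ρ |T|`. -/
theorem isSelfAdjoint_polarUnitary {T : H →L[ℂ] H} (hT : T * T = 1) :
    IsSelfAdjoint (polarUnitary T) := by
  have hTu : IsUnit T := ⟨⟨T, T, hT, hT⟩, rfl⟩
  have hau : IsUnit (CFC.abs T) := isUnit_abs_of_isUnit hTu
  have hpa : polarUnitary T * CFC.abs T = T := polarUnitary_mul_abs hTu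
  obtain ⟨hρ1, -⟩ := Unitary.mem_iff.1 (polarUnitary_mem_unitary hTu)
  set ρ := polarUnitary T
  set a := CFC.abs T
  have ha : star a = a := (CFC.abs_nonneg T).isSelfAdjoint
  have hTs : star T * star T = 1 := by rw [← star_mul, hT, star_one]
  have haa : a * a = star T * T := CFC.abs_mul_abs T
  have hρρ : ∀ b : H →L[ℂ] H, star ρ * (ρ * b) = b := fun b => by rw [← mul_assoc, hρ1, one_mul]
  have hb : CFC.abs (star T) = ρ * a * star ρ := by
    refine CFC.sqrt_unique ?_ ?_
    · rw [star_star]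
      calc ρ * a * star ρ * (ρ * a * star ρ) = (ρ * a) * (a * star ρ) := by
            simp only [mul_assoc, hρρ]
        _ = T * star T := by rw [hpa, ← hpa, star_mul, ha]
    · have := star_left_conjugate_nonneg (CFC.abs_nonneg T) (star ρ)
      rwa [star_star] at this
  obtain ⟨u, hu⟩ := hau
  have huinv : CFC.abs (star T) = (u⁻¹ : (H →L[ℂ] H)ˣ) := by
    refine CFC.sqrt_unique ?_ (CFC.inv_nonneg_of_nonneg u (hu ▸ CFC.abs_nonneg T))
    have h1 : (u * u : H →L[ℂ] H) * (T * star T) = 1 := by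
      rw [hu, haa, mul_assoc, ← mul_assoc T T, hT, one_mul, hTs]
    rw [star_star, ← mul_one ((u⁻¹ : (H →L[ℂ] H)ˣ) * (u⁻¹ : (H →L[ℂ] H)ˣ) : H →L[ℂ] H), ← h1]
    simp only [mul_assoc, Units.inv_mul_cancel_left]
  have h1 : T * (star ρ * a) = 1 := by
    rw [← mul_assoc, ← hpa, ← hb, huinv, ← hu, Units.inv_mul]
  have h2 : star ρ * a = ρ * a := by
    rw [hpa, ← one_mul (star ρ * a), ← hT, mul_assoc, h1, mul_one]
  exact (hu ▸ u.isUnit : IsUnit a).mul_right_cancel h2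

section

variable {Q : H →L[ℂ] H}

theorem isSelfAdjoint_rho (hQ : IsIdempotentElem Q) : IsSelfAdjoint (rho Q) :=
  isSelfAdjoint_polarUnitary (two_mul_sub_one_mul_self hQ)

theorem rho_mem_unitary (hQ : IsIdempotentElem Q) : rho Q ∈ unitary (H →L[ℂ] H) :=
  polarUnitary_mem_unitary (isUnit_two_mul_sub_one hQ)

theorem rho_mul_self (hQ : IsIdempotentElem Q) : rho Q * rho Q = 1 := by
  have h := (Unitary.mem_iff.1 (rho_mem_unitary hQ)).1
  rwa [(isSelfAdjoint_rho hQ).star_eq] at h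

/-- The symmetry `ρ_Q` intertwines `Q` and `Q⋆`: both `ρ_Q (2Q - 1)` and `(2Q⋆ - 1) ρ_Q` are equal
to `|2Q - 1|`. -/
theorem rho_mul_eq_star_mul_rho (hQ : IsIdempotentElem Q) : rho Q * Q = star Q * rho Q := by
  have hpa : rho Q * CFC.abs (2 * Q - 1) = 2 * Q - 1 :=
    polarUnitary_mul_abs (isUnit_two_mul_sub_one hQ)
  have hρ := rho_mul_self hQ
  have h1 : rho Q * (2 * Q - 1) = CFC.abs (2 * Q - 1) := by
    nth_rw 1 [← hpa]
    rw [← mul_assoc, hρ, one_mul]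
  have h2 : star (2 * Q - 1) * rho Q = CFC.abs (2 * Q - 1) := by
    have := congrArg star h1
    rwa [star_mul, (isSelfAdjoint_rho hQ).star_eq,
      (CFC.abs_nonneg (2 * Q - 1)).isSelfAdjoint.star_eq] at this
  have h3 : (2 : ℂ) • (rho Q * Q) = (2 : ℂ) • (star Q * rho Q) := by
    have h := h1.trans h2.symm
    rw [star_sub, star_mul, star_one, mul_sub, sub_mul, mul_one, one_mul, sub_left_inj] at h
    simpa [two_smul, two_mul, mul_two, mul_add, add_mul] using h
  exact smul_right_injective _ (two_ne_zero (α := ℂ)) h3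

variable {L₀ : Submodule ℂ H} [L₀.HasOrthogonalProjection]

/-- `ρ_Q` maps `R(Q)` onto `R(Q⋆) = N(Q)ᗮ`, so it conjugates the orthogonal projections onto these
subspaces into each other. -/
theorem rho_conj_starProjection [Q.ker.HasOrthogonalProjection] (hQ : IsIdempotentElem Q)
    (hL₀ : Q.range = L₀) : rho Q * L₀.starProjection * rho Q = 1 - Q.ker.starProjection := by
  have hρ := isSelfAdjoint_rho hQ
  have hρρ := rho_mul_self hQ
  have hρQ := rho_mul_eq_star_mul_rho hQ
  have hP₀ : IsSelfAdjoint L₀.starProjection := isSelfAdjoint_starProjection L₀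
  have hR : IsSelfAdjoint (1 - Q.ker.starProjection) :=
    (IsSelfAdjoint.one _).sub (isSelfAdjoint_starProjection _)
  set E := rho Q * L₀.starProjection * rho Q
  set R := 1 - Q.ker.starProjection
  have hE : IsSelfAdjoint E := by
    rw [IsSelfAdjoint]
    simp only [E, star_mul, hρ.star_eq, hP₀.star_eq, mul_assoc]
  have hstar : star Q = rho Q * Q * rho Q := by rw [hρQ, mul_assoc, hρρ, mul_one]
  have hEQ : E * star Q = star Q := by
    rw [hstar]
    calc rho Q * L₀.starProjection * rho Q * (rho Q * Q * rho Q)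
        = rho Q * L₀.starProjection * (rho Q * rho Q) * Q * rho Q := by simp only [mul_assoc]
      _ = rho Q * (L₀.starProjection * Q) * rho Q := by rw [hρρ, mul_one]; simp only [mul_assoc]
      _ = rho Q * Q * rho Q := by rw [starProjection_mul_of_range_eq hL₀]
  have hQE : star Q * E = E := by
    rw [hstar]
    calc rho Q * Q * rho Q * (rho Q * L₀.starProjection * rho Q)
        = rho Q * Q * (rho Q * rho Q) * L₀.starProjection * rho Q := by simp only [mul_assoc]
      _ = rho Q * (Q * L₀.starProjection) * rho Q := by rw [hρρ, mul_one]; simp only [mul_assoc]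
      _ = rho Q * L₀.starProjection * rho Q := by rw [mul_starProjection_of_range_eq hQ hL₀]
  have hRQ : R * star Q = star Q := by
    rw [← hR.star_eq, ← star_mul, mul_one_sub_starProjection_ker]
  have hQR : star Q * R = R := by
    rw [← hR.star_eq, ← star_mul, one_sub_starProjection_ker_mul hQ]
  have h1 : E * R = R := by rw [← hQR, ← mul_assoc, hEQ]
  have h2 : R * E = E := by rw [← hQE, ← mul_assoc, hRQ]
  calc E = star (R * E) := by rw [h2, hE.star_eq]
    _ = E * R := by rw [star_mul, hE.star_eq, hR.star_eq]
    _ = R := h1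

/-- On `L₀` the operators `Q Q⋆` and `P₀ P_{N(Q)ᗮ} P₀` are inverse to each other, and both vanish
on `L₀ᗮ`. -/
theorem mul_star_mul_complementCompression [Q.ker.HasOrthogonalProjection]
    (hQ : IsIdempotentElem Q) (hL₀ : Q.range = L₀) :
    Q * star Q * complementCompression L₀ Q.ker = L₀.starProjection := by
  have hP₀ : IsSelfAdjoint L₀.starProjection := isSelfAdjoint_starProjection L₀
  have hR : IsSelfAdjoint (1 - Q.ker.starProjection) :=
    (IsSelfAdjoint.one _).sub (isSelfAdjoint_starProjection _)
  have h1 : star Q * L₀.starProjection = star Q := by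
    rw [← hP₀.star_eq, ← star_mul, starProjection_mul_of_range_eq hL₀]
  have h2 : star Q * (1 - Q.ker.starProjection) = 1 - Q.ker.starProjection := by
    rw [← hR.star_eq, ← star_mul, one_sub_starProjection_ker_mul hQ]
  calc Q * star Q * (L₀.starProjection * (1 - Q.ker.starProjection) * L₀.starProjection)
      = Q * (star Q * L₀.starProjection * (1 - Q.ker.starProjection)) * L₀.starProjection := by
        simp only [mul_assoc]
    _ = L₀.starProjection := by
        rw [h1, h2, mul_one_sub_starProjection_ker, mul_starProjection_of_range_eq hQ hL₀]

theorem complementCompression_mul_mul_star [Q.ker.HasOrthogonalProjection]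
    (hQ : IsIdempotentElem Q) (hL₀ : Q.range = L₀) :
    complementCompression L₀ Q.ker * (Q * star Q) = L₀.starProjection := by
  have h := congrArg star (mul_star_mul_complementCompression hQ hL₀)
  rwa [star_mul, (isSelfAdjoint_complementCompression _ _).star_eq, star_mul, star_star,
    (isSelfAdjoint_starProjection L₀).star_eq] at h

theorem eigenvectorsTotal_mul_star_iff [Q.ker.HasOrthogonalProjection] (hQ : IsIdempotentElem Q)
    (hL₀ : Q.range = L₀) :
    EigenvectorsTotal (Q * star Q) ↔ EigenvectorsTotal (complementCompression L₀ Q.ker) := by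
  have hP₀ : IsSelfAdjoint L₀.starProjection := isSelfAdjoint_starProjection L₀
  have hPP : L₀.starProjection * L₀.starProjection = L₀.starProjection :=
    L₀.isIdempotentElem_starProjection
  have hGD := mul_star_mul_complementCompression hQ hL₀
  have hDG := complementCompression_mul_mul_star hQ hL₀
  have hPG : L₀.starProjection * (Q * star Q) = Q * star Q := by
    rw [← mul_assoc, starProjection_mul_of_range_eq hL₀]
  have hGP : Q * star Q * L₀.starProjection = Q * star Q := by
    have h := congrArg star hPG
    rwa [star_mul, star_mul, star_star, hP₀.star_eq] at h
  have hPD : L₀.starProjection * complementCompression L₀ Q.ker =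
      complementCompression L₀ Q.ker := by
    simp only [complementCompression, ← mul_assoc, hPP]
  have hDP : complementCompression L₀ Q.ker * L₀.starProjection =
      complementCompression L₀ Q.ker := by
    simp only [complementCompression, mul_assoc, hPP]
  exact ⟨fun h => h.mono fun _ _ => exists_apply_eq_smul_of_mul_eq hDG hPG hDP,
    fun h => h.mono fun _ _ => exists_apply_eq_smul_of_mul_eq hGD hPD hGP⟩

variable [CompleteSpace L₀]

open ContinuousLinearMap in
theorem adjoint_compression (T : H →L[ℂ] H) :
    adjoint (L₀.orthogonalProjectionOnto ∘L T ∘L L₀.subtypeL) =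
      L₀.orthogonalProjectionOnto ∘L adjoint T ∘L L₀.subtypeL := by
  rw [adjoint_comp, adjoint_comp, Submodule.adjoint_subtypeL,
    Submodule.adjoint_orthogonalProjectionOnto, comp_assoc]

open ContinuousLinearMap in
theorem rho_mem_Sd_iff [Q.ker.HasOrthogonalProjection] (hQ : IsIdempotentElem Q)
    (hL₀ : Q.range = L₀) :
    rho Q ∈ Sd L₀ ↔ EigenvectorsTotal (complementCompression L₀ Q.ker) := by
  rw [Sd, Set.mem_ofPred_eq, and_iff_right (rho_mem_unitary hQ),
    isSchmidtDecomposable_iff_eigenvectorsTotal]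
  refine eigenvectorsTotal_iff_of_comp_subtypeL (isPositive_adjoint_comp_self _).isSelfAdjoint
    (isSelfAdjoint_complementCompression _ _) ?_ fun z hz => ?_
  · have hρ : adjoint (rho Q) = rho Q := (isSelfAdjoint_rho hQ).star_eq
    rw [adjoint_compression, hρ, complementCompression, ← rho_conj_starProjection hQ hL₀]
    ext x
    have hx : L₀.starProjection (x : H) = x := Submodule.starProjection_eq_self_iff.2 x.2
    change L₀.starProjection (rho Q (L₀.starProjection (rho Q (L₀.starProjection (x : H))))) =
      L₀.starProjection (rho Q (L₀.starProjection (rho Q (x : H))))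
    rw [hx]
  · rw [complementCompression_apply, (Submodule.starProjection_apply_eq_zero_iff _).2 hz]
    simp

open ContinuousLinearMap in
/-- `A A† = Q Q† - 1` on `L₀`. -/
theorem isSchmidtDecomposable_upperRightEntry_iff (hQ : IsIdempotentElem Q) (hL₀ : Q.range = L₀) :
    IsSchmidtDecomposable (upperRightEntry L₀ Q) ↔ EigenvectorsTotal (Q * star Q) := by
  rw [isSchmidtDecomposable_iff_eigenvectorsTotal, ← eigenvectorsTotal_comp_adjoint_iff]
  set A := upperRightEntry L₀ Q with hA
  have hAA : IsSelfAdjoint (A ∘L adjoint A) := by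
    have := (isPositive_adjoint_comp_self (adjoint A)).isSelfAdjoint
    rwa [adjoint_adjoint] at this
  have hQQ : IsSelfAdjoint (Q * star Q) := IsSelfAdjoint.mul_star_self Q
  have hP₀ : IsSelfAdjoint L₀.starProjection := isSelfAdjoint_starProjection L₀
  have h1 : EigenvectorsTotal (A ∘L adjoint A) ↔ EigenvectorsTotal (A ∘L adjoint A + 1) := by
    refine ⟨fun h => h.mono fun μ v hv => ⟨μ + 1, ?_⟩, fun h => h.mono fun μ v hv => ⟨μ - 1, ?_⟩⟩
    · rw [add_apply, hv, one_apply_eq_self, add_smul, one_smul]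
    · rw [add_apply, one_apply_eq_self] at hv
      rw [sub_smul, one_smul, ← hv, add_sub_cancel_right]
  rw [h1]
  have hPQ := starProjection_mul_of_range_eq hL₀
  have hQP := mul_starProjection_of_range_eq hQ hL₀
  have hQP' : star Q * L₀.starProjection = star Q := by
    rw [← hP₀.star_eq, ← star_mul, hPQ]
  have hPQ' : L₀.starProjection * star Q = L₀.starProjection := by
    have := congrArg star hQP
    rwa [star_mul, hP₀.star_eq] at this
  refine eigenvectorsTotal_iff_of_comp_subtypeL (hAA.add (IsSelfAdjoint.one _)) hQQ ?_
    fun z hz => ?_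
  · ext x
    have hx : L₀.starProjection (x : H) = x := Submodule.starProjection_eq_self_iff.2 x.2
    have hx' : L₀.starProjection (star Q (x : H)) = x := by
      have := congrArg (fun S : H →L[ℂ] H => S x) hPQ'
      exact this.trans hx
    have hAadj : (adjoint A x : H) = star Q x - x := by
      rw [hA, upperRightEntry, adjoint_comp, adjoint_comp, Submodule.adjoint_subtypeL,
        Submodule.adjoint_orthogonalProjectionOnto]
      change L₀ᗮ.starProjection (star Q (x : H)) = _
      rw [Submodule.starProjection_orthogonal_val, hx']
    have hQx : Q (x : H) = x := by
      have := congrArg (fun S : H →L[ℂ] H => S x) hQP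
      simpa [mul_apply_eq_comp, hx] using this
    have hAapp : ∀ y : L₀ᗮ, (A y : H) = Q y := fun y => by
      have := congrArg (fun S : H →L[ℂ] H => S y) hPQ
      exact this
    change Q (star Q x) = (A (adjoint A x) : H) + x
    rw [hAapp, hAadj, map_sub, hQx, sub_add_cancel]
  · have := congrArg (fun S : H →L[ℂ] H => S z) hQP'
    simp only [mul_apply_eq_comp, (Submodule.starProjection_apply_eq_zero_iff _).2 hz,
      map_zero] at this
    rw [mul_apply_eq_comp, ← this, map_zero]

end

end

/-! ### Existence of a Halmos model -/

section

section

variable {E F : Type*} [NormedAddCommGroup E] [InnerProductSpace ℂ E]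
  [NormedAddCommGroup F] [InnerProductSpace ℂ F] [CompleteSpace F]

theorem denseRange_of_forall_inner_eq_zero {A : E →L[ℂ] F}
    (h : ∀ y, (∀ x, ⟪A x, y⟫_ℂ = 0) → y = 0) : DenseRange A := by
  have h1 : A.rangeᗮ = ⊥ := by
    rw [Submodule.eq_bot_iff]
    exact fun y hy => h y fun x =>
      (Submodule.mem_orthogonal _ y).1 hy _ (LinearMap.mem_range_self _ x)
  have h2 := Submodule.topologicalClosure_eq_top_iff.2 h1
  rwa [← Submodule.dense_iff_topologicalClosure_eq_top] at h2

variable [CompleteSpace E]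

/-- The unitary part of a polar decomposition: operators with dense ranges and `‖B x‖ = ‖K x‖`
differ by a unitary. -/
theorem exists_linearIsometryEquiv_apply_eq {G : Type*} [NormedAddCommGroup G]
    [InnerProductSpace ℂ G] {K : G →L[ℂ] E} {B : G →L[ℂ] F} (hK : DenseRange K)
    (hB : DenseRange B) (h : ∀ x, ‖B x‖ = ‖K x‖) : ∃ U : E ≃ₗᵢ[ℂ] F, ∀ x, U (K x) = B x :=
  ⟨(LinearEquiv.refl ℂ G).extendOfIsometry (K : G →ₗ[ℂ] E) (B : G →ₗ[ℂ] F) hK hB h,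
    fun x => LinearEquiv.extendOfIsometry_eq (LinearEquiv.refl ℂ G) (K : G →ₗ[ℂ] E)
      (B : G →ₗ[ℂ] F) hK hB h x⟩

theorem exists_cfc_cos_sq_eq {A : E →L[ℂ] E} (h0 : 0 ≤ A) (h1 : A ≤ 1) :
    ∃ X : E →L[ℂ] E, 0 ≤ X ∧ X ≤ (Real.pi / 2) • (1 : E →L[ℂ] E) ∧ cfc Real.cos X ^ 2 = A := by
  have hA : IsSelfAdjoint A := h0.isSelfAdjoint
  have hc : Continuous fun x : ℝ => Real.arccos (√x) :=
    Real.continuous_arccos.comp Real.continuous_sqrt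
  refine ⟨cfc (fun x => Real.arccos (√x)) A, cfc_nonneg fun x _ => Real.arccos_nonneg _, ?_, ?_⟩
  · rw [← Algebra.algebraMap_eq_smul_one]
    exact cfc_le_algebraMap _ _ A fun x _ =>
      Real.arccos_le_pi_div_two.2 (Real.sqrt_nonneg x)
  · rw [← cfc_comp' Real.cos (fun x => Real.arccos (√x)) A (by fun_prop) hc.continuousOn,
      ← cfc_pow _ 2 A (by fun_prop)]
    refine (cfc_congr fun x hx => ?_).trans (cfc_id ℝ A)
    obtain ⟨hx0, hx1⟩ := spectrum_subset_Icc h0 (by rwa [one_smul] : A ≤ (1 : ℝ) • 1) hx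
    simp only [id]
    rw [Real.cos_arccos (by linarith [Real.sqrt_nonneg x]) (Real.sqrt_le_one.2 hx1),
      Real.sq_sqrt hx0]

end

variable {H : Type u} [NormedAddCommGroup H] [InnerProductSpace ℂ H]

theorem isClosed_of_hasOrthogonalProjection (S : Submodule ℂ H) [S.HasOrthogonalProjection] :
    IsClosed (S : Set H) := by
  rw [← S.orthogonal_orthogonal]
  exact Sᗮ.isClosed_orthogonal

variable [CompleteSpace H]

/-- Halmos' two projections theorem.  The model space is `L = S ⊓ H'`, where `H'` is the generic
part, and `cos² X` is the compression of `P_T` to `L`.  The off-diagonal entry `P_{Sᗮ} P_T` of `P_T`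
has absolute value `cos X sin X` on `L`; the unitary part of its polar decomposition identifies
`L` with `Sᗮ ⊓ H'`. -/
theorem exists_isHalmosAngle (S T : Submodule ℂ H) [S.HasOrthogonalProjection]
    [T.HasOrthogonalProjection] :
    ∃ (L : Type u) (_ : NormedAddCommGroup L) (_ : InnerProductSpace ℂ L) (_ : CompleteSpace L)
      (X : L →L[ℂ] L), IsHalmosAngle S T X := by
  have hGc : IsClosed (genericPart S T : Set H) := Submodule.isClosed_orthogonal _
  let L : Submodule ℂ H := S ⊓ genericPart S T
  let M : Submodule ℂ H := Sᗮ ⊓ genericPart S T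
  have hLcomp : CompleteSpace L :=
    ((isClosed_of_hasOrthogonalProjection S).inter hGc).completeSpace_coe
  have hMcomp : CompleteSpace M := (S.isClosed_orthogonal.inter hGc).completeSpace_coe
  have hS : ∀ w ∈ S, S.starProjection w = w := fun w hw =>
    Submodule.starProjection_eq_self_iff.2 hw
  have hS' : ∀ w ∈ Sᗮ, S.starProjection w = 0 := fun w hw =>
    (Submodule.starProjection_apply_eq_zero_iff _).2 hw
  have hTmem : ∀ {z}, z ∈ genericPart S T → T.starProjection z ∈ genericPart S T :=
    starProjection_right_mem_genericPart
  have hLM : ∀ z ∈ genericPart S T, S.starProjection z ∈ L ∧ z - S.starProjection z ∈ M :=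
    fun z hz => ⟨⟨S.starProjection_apply_mem z, starProjection_mem_genericPart hz⟩,
      S.sub_starProjection_mem_orthogonal z, sub_mem hz (starProjection_mem_genericPart hz)⟩
  have hinner : ∀ (x : L) (y : M), ⟪(x : H), (y : H)⟫_ℂ = 0 := fun x y =>
    (Submodule.mem_orthogonal _ _).1 y.2.1 x x.2.1
  -- the first column of the matrix of `P_T` on the generic part
  let A : L →L[ℂ] L := L.orthogonalProjectionOnto ∘L T.starProjection ∘L L.subtypeL
  let B : L →L[ℂ] M := M.orthogonalProjectionOnto ∘L T.starProjection ∘L L.subtypeL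
  have hA : ∀ x : L, (A x : H) = S.starProjection (T.starProjection x) := fun x => by
    obtain ⟨h1, h2⟩ := hLM _ (hTmem x.2.2)
    exact Submodule.eq_starProjection_of_mem_of_inner_eq_zero h1 fun w hw =>
      inner_eq_zero_symm.1 (hinner ⟨w, hw⟩ ⟨_, h2⟩)
  have hB : ∀ x : L, (B x : H) = T.starProjection x - S.starProjection (T.starProjection x) :=
    fun x => by
    obtain ⟨h1, h2⟩ := hLM _ (hTmem x.2.2)
    refine Submodule.eq_starProjection_of_mem_of_inner_eq_zero h2 fun w hw => ?_
    change ⟪T.starProjection (x : H) - (T.starProjection x - _), w⟫_ℂ = 0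
    rw [sub_sub_cancel]
    exact hinner ⟨_, h1⟩ ⟨w, hw⟩
  have hAB : ∀ x : L, T.starProjection (x : H) = A x + B x := fun x => by
    rw [hA, hB, add_sub_cancel]
  have hAinner : ∀ x y : L, ⟪A x, y⟫_ℂ = ⟪T.starProjection (x : H), T.starProjection (y : H)⟫_ℂ :=
    fun x y => by
    rw [Submodule.inner_starProjection_left_eq_right,
      Submodule.starProjection_eq_self_iff.2 (T.starProjection_apply_mem _), Submodule.coe_inner,
      hA, Submodule.inner_starProjection_left_eq_right, hS _ y.2.1,
      Submodule.inner_starProjection_left_eq_right]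
  have hAadj : ContinuousLinearMap.adjoint A = A := by
    rw [adjoint_compression, (isSelfAdjoint_starProjection T).adjoint_eq]
  have hAsa : IsSelfAdjoint A := hAadj
  have hA0 : 0 ≤ A := by
    rw [ContinuousLinearMap.nonneg_iff_isPositive, ContinuousLinearMap.isPositive_def']
    refine ⟨hAsa, fun x => ?_⟩
    rw [ContinuousLinearMap.reApplyInnerSelf_apply, hAinner]
    exact inner_self_nonneg
  have hA1 : A ≤ 1 := by
    rw [ContinuousLinearMap.le_def, ContinuousLinearMap.isPositive_def']
    refine ⟨(IsSelfAdjoint.one _).sub hAsa, fun x => ?_⟩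
    rw [ContinuousLinearMap.reApplyInnerSelf_apply, sub_apply, inner_sub_left, hAinner, map_sub,
      one_apply_eq_self, ← norm_sq_eq_re_inner, ← norm_sq_eq_re_inner, sub_nonneg]
    exact pow_le_pow_left₀ (norm_nonneg _) (T.norm_starProjection_apply_le _) 2
  obtain ⟨X, hX0, hX1, hcos⟩ := exists_cfc_cos_sq_eq hA0 hA1
  have hXsa : IsSelfAdjoint X := hX0.isSelfAdjoint
  have hsin : cfc Real.sin X ^ 2 = 1 - A := by
    rw [← hcos, ← cfc_cos_sq_add_cfc_sin_sq hXsa, add_sub_cancel_left]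
  have hAinj : ∀ x : L, A x = 0 → x = 0 := fun x hx => by
    have h1 : S.starProjection (T.starProjection x) = 0 := by rw [← hA, hx]; rfl
    have h2 : T.starProjection (x : H) = 0 := eq_zero_of_mem_genericPart (hTmem x.2.2)
      (.inr (.inr (.inr ⟨(Submodule.starProjection_apply_eq_zero_iff _).1 h1,
        T.starProjection_apply_mem _⟩)))
    exact Subtype.ext (eq_zero_of_mem_genericPart x.2.2
      (.inr (.inr (.inl ⟨x.2.1, (Submodule.starProjection_apply_eq_zero_iff _).1 h2⟩))))
  have hAinj' : ∀ x : L, (1 - A) x = 0 → x = 0 := fun x hx => by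
    have h1 : S.starProjection ((x : H) - T.starProjection x) = 0 := by
      rw [map_sub, hS _ x.2.1, ← hA, ← Submodule.coe_sub]
      exact congrArg Subtype.val hx
    have h2 : (x : H) - T.starProjection x = 0 :=
      eq_zero_of_mem_genericPart (sub_mem x.2.2 (hTmem x.2.2))
        (.inr (.inl ⟨(Submodule.starProjection_apply_eq_zero_iff _).1 h1,
          T.sub_starProjection_mem_orthogonal _⟩))
    exact Subtype.ext (eq_zero_of_mem_genericPart x.2.2
      (.inl ⟨x.2.1, Submodule.starProjection_eq_self_iff.1 (sub_eq_zero.1 h2).symm⟩))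
  have hcosinj : ∀ x, (cfc Real.cos X) x = 0 → x = 0 := fun x hx => hAinj x (by
    rw [← hcos, pow_two, mul_apply_eq_comp, hx, map_zero])
  have hsininj : ∀ x, (cfc Real.sin X) x = 0 → x = 0 := fun x hx => hAinj' x (by
    rw [← hsin, pow_two, mul_apply_eq_comp, hx, map_zero])
  have hXinj : ∀ x, X x = 0 → x = 0 := fun x hx => hsininj x (by
    rw [cfc_apply_of_apply_eq_smul hXsa (μ := 0) (by simp [hx]) (by fun_prop)]
    simp)
  -- `B` and `K = cos X sin X` have the same absolute value
  set K := cfc Real.cos X * cfc Real.sin X with hK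
  have hcomm : Commute (cfc Real.cos X) (cfc Real.sin X) := cfc_commute_cfc _ _ X
  have hKsa : IsSelfAdjoint K :=
    (IsSelfAdjoint.commute_iff (cfc_predicate Real.cos X) (cfc_predicate Real.sin X)).1 hcomm
  have hKadj : ∀ x y, ⟪K x, y⟫_ℂ = ⟪x, K y⟫_ℂ := fun x y => by
    rw [← ContinuousLinearMap.adjoint_inner_left, hKsa.adjoint_eq]
  have hKK : K * K = A * (1 - A) := by
    rw [← hsin, ← hcos, ← pow_two, hK, hcomm.mul_pow]
  have hnorm : ∀ x, ‖B x‖ = ‖K x‖ := fun x => by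
    have h1 : ⟪B x, B x⟫_ℂ = ⟪A x, (1 - A) x⟫_ℂ := by
      have h2 := hAinner x x
      rw [hAB, inner_add_left, inner_add_right, inner_add_right, hinner, inner_eq_zero_symm.1
        (hinner (A x) (B x)), ← Submodule.coe_inner, ← Submodule.coe_inner, add_zero,
        zero_add] at h2
      rw [sub_apply, one_apply_eq_self, inner_sub_right, h2, add_sub_cancel_left]
    have h3 : ⟪K x, K x⟫_ℂ = ⟪A x, (1 - A) x⟫_ℂ := by
      rw [hKadj, ← mul_apply_eq_comp, hKK, mul_apply_eq_comp,
        ← ContinuousLinearMap.adjoint_inner_left, hAadj]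
    rw [@norm_eq_sqrt_re_inner ℂ, @norm_eq_sqrt_re_inner ℂ, h1, h3]
  have hKdense : DenseRange K := denseRange_of_forall_inner_eq_zero fun y hy => by
    have h1 : K y = 0 := by
      have := hy (K y)
      rwa [hKadj, inner_self_eq_zero] at this
    exact hsininj _ (hcosinj _ h1)
  have hBdense : DenseRange B := denseRange_of_forall_inner_eq_zero fun y hy => by
    have h1 : ∀ x : L, ⟪(x : H), T.starProjection (y : H)⟫_ℂ = 0 := fun x => by
      rw [← Submodule.inner_starProjection_left_eq_right, hAB, inner_add_left, hinner, zero_add]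
      exact hy x
    have h2 : S.starProjection (T.starProjection (y : H)) = 0 := by
      have := h1 ⟨_, (hLM _ (hTmem y.2.2)).1⟩
      rw [Subtype.coe_mk, Submodule.inner_starProjection_left_eq_right] at this
      rw [← inner_self_eq_zero (𝕜 := ℂ), Submodule.inner_starProjection_left_eq_right,
        hS _ (S.starProjection_apply_mem _)]
      exact this
    have h3 : T.starProjection (y : H) = 0 := eq_zero_of_mem_genericPart (hTmem y.2.2)
      (.inr (.inr (.inr ⟨(Submodule.starProjection_apply_eq_zero_iff _).1 h2,
        T.starProjection_apply_mem _⟩)))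
    exact Subtype.ext (eq_zero_of_mem_genericPart y.2.2
      (.inr (.inl ⟨y.2.1, (Submodule.starProjection_apply_eq_zero_iff _).1 h3⟩)))
  obtain ⟨U, hU⟩ := exists_linearIsometryEquiv_apply_eq hKdense hBdense hnorm
  -- the second column of `P_T`, computed on the dense range of `K`: there `U K x = P_T x - A x`,
  -- so idempotence of `P_T` reduces it to the first column
  have hPU : ∀ y : L, T.starProjection (U y : H) = K y + U ((1 - A) y) := fun y => by
    refine hKdense.induction_on (p := fun y : L => T.starProjection (U y : H) = K y + U ((1 - A) y))
      y (isClosed_eq (by fun_prop) (by fun_prop)) fun x => ?_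
    have hKA : K ((1 - A) x) = (1 - A) (K x) := by
      rw [← hsin, ← mul_apply_eq_comp, ← mul_apply_eq_comp, hK,
        (hcomm.mul_left (Commute.refl _)).pow_right 2 |>.eq]
    have hBx : (B x : H) = T.starProjection x - A x := by rw [hAB, add_sub_cancel_left]
    rw [← hKA, hU, hU, ← mul_apply_eq_comp, hKK, mul_apply_eq_comp, ← hAB, hBx, map_sub,
      Submodule.starProjection_eq_self_iff.2 (T.starProjection_apply_mem _), ← map_sub]
    rfl
  -- the model map `(x, y) ↦ x + U y`, isometric since `L ⊆ S` and the range of `U` is in `Sᗮ`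
  let W₀ : WithLp 2 (L × L) →ₗᵢ[ℂ] genericPart S T :=
    { toFun := fun p => ⟨p.fst + U p.snd, add_mem p.fst.2.2 (U p.snd).2.2⟩
      map_add' := fun p q => Subtype.ext (by
        simp only [WithLp.add_fst, WithLp.add_snd, map_add, Submodule.coe_add]
        abel)
      map_smul' := fun c p => Subtype.ext (by
        simp only [WithLp.smul_fst, WithLp.smul_snd, map_smul, Submodule.coe_smul, smul_add,
          RingHom.id_apply])
      norm_map' := fun p => by
        change ‖(p.fst : H) + U p.snd‖ = ‖p‖
        rw [WithLp.prod_norm_eq_of_L2, eq_comm, Real.sqrt_eq_iff_mul_self_eq (by positivity)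
          (norm_nonneg _), norm_add_sq_eq_norm_sq_add_norm_sq_of_inner_eq_zero _ _ (hinner _ _),
          ← Submodule.coe_norm, ← Submodule.coe_norm, U.norm_map, pow_two, pow_two] }
  have hW₀ : ∀ x y : L, (W₀ (WithLp.toLp 2 (x, y)) : H) = x + U y := fun _ _ => rfl
  have hsurj : Function.Surjective W₀ := fun z => by
    obtain ⟨h1, h2⟩ := hLM z z.2
    refine ⟨WithLp.toLp 2 (⟨_, h1⟩, U.symm ⟨_, h2⟩), Subtype.ext ?_⟩
    rw [hW₀, U.apply_symm_apply, add_sub_cancel]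
  refine ⟨L, inferInstance, inferInstance, hLcomp, X, hX0, hX1, hXinj, hcosinj, hsininj,
    LinearIsometryEquiv.ofSurjective W₀ hsurj, fun x y => ?_⟩
  simp only [LinearIsometryEquiv.coe_ofSurjective, hW₀, map_add, hS _ x.2.1, hS' _ (U y).2.1,
    hcos, hsin, hPU, hAB, map_zero, Submodule.coe_zero, Submodule.coe_add, true_and]
  rw [← hK, hU]
  abel

end

/-! ### The equivalences -/

theorem mainTheorem4 {H : Type u} [NormedAddCommGroup H] [InnerProductSpace ℂ H]
    [CompleteSpace H] (L₀ : Submodule ℂ H) [CompleteSpace L₀]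
    (Q : H →L[ℂ] H) (hQ : IsIdempotentElem Q) (hL₀ : Q.range = L₀) :
    (∃ (L : Type u) (_ : NormedAddCommGroup L) (_ : InnerProductSpace ℂ L) (_ : CompleteSpace L)
      (X : L →L[ℂ] L), IsHalmosAngle L₀ Q.ker X) ∧
    ∀ (L : Type v) [NormedAddCommGroup L] [InnerProductSpace ℂ L] [CompleteSpace L]
      (X : L →L[ℂ] L), IsHalmosAngle L₀ Q.ker X →
      List.TFAE [
        rho Q ∈ Sd L₀,
        IsDiagonalizable X,
        IsDiagonalizable (Q ∘L ContinuousLinearMap.adjoint Q),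
        IsDiagonalizable (ContinuousLinearMap.adjoint Q ∘L Q),
        IsSchmidtDecomposable (upperRightEntry L₀ Q)] := by
  refine ⟨exists_isHalmosAngle _ _, fun L _ _ _ X hX => ?_⟩
  have hXsa : IsSelfAdjoint X := hX.1.isSelfAdjoint
  have hQQ : IsSelfAdjoint (Q * star Q) := IsSelfAdjoint.mul_star_self Q
  have hQQ' : IsSelfAdjoint (star Q * Q) := IsSelfAdjoint.star_mul_self Q
  have h3 : IsDiagonalizable (Q ∘L ContinuousLinearMap.adjoint Q) ↔
      EigenvectorsTotal (Q * star Q) := isDiagonalizable_iff_eigenvectorsTotal hQQ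
  tfae_have 1 ↔ 3 := by rw [h3, rho_mem_Sd_iff hQ hL₀, eigenvectorsTotal_mul_star_iff hQ hL₀]
  tfae_have 2 ↔ 3 := by
    rw [h3, isDiagonalizable_iff_eigenvectorsTotal hXsa, hX.eigenvectorsTotal_iff,
      eigenvectorsTotal_mul_star_iff hQ hL₀]
  tfae_have 3 ↔ 4 := by
    rw [h3]
    exact eigenvectorsTotal_comp_adjoint_iff.trans
      (isDiagonalizable_iff_eigenvectorsTotal hQQ').symm
  tfae_have 5 ↔ 3 := by rw [h3, isSchmidtDecomposable_upperRightEntry_iff hQ hL₀]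
  tfae_finish
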